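/- A binary constraint system (BCS) consists of $n$ Boolean variables $v_1,\dots,v_n$ and $m$ constraints, the $s$-th of which is a Boolean function of a nonempty set $X_s$ of the variables. In its game the verifier picks a constraint $s$ and a variable $t\in X_s$ uniformly at random, sends $s$ to Alice and $t$ to Bob, receives a truth assignment to $X_s$ from Alice and a truth value for $v_t$ from Bob, and accepts iff Alice's assignment satisfies the constraint and agrees with Bob's value on $v_t$. A quantum strategy consists of a unit vector $\psi$ in a Hilbert space tensor product $\mathcal H_A\otimes\mathcal H_B$ of complex Hilbert spaces, a POVM $(E^s_a)_{a\in\{0,1\}^{X_s}}$ on $\mathcal H_A$ for each $s$, and a POVM $(F^t_b)_{b\in\{0,1\}}$ on $\mathcal H_B$ for each $t$ (projective measurements are a special case). It is perfect if the verifier accepts with probability $1$ for every possible pair of questions. It uses finite or countably-infinite dimensional entanglement if $\psi=\sum_{i\in I}\alpha_i\,\phi_i\otimes\chi_i$ with $I$ finite or countably infinite, $\alpha_i>0$, and $(\phi_i)$, $(\chi_i)$ orthonormal families (not necessarily complete). A quantum satisfying assignment of the BCS is a family $A_1,\dots,A_n$ of Hermitian operators on a nonzero finite-dimensional complex Hilbert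 space such that $A_i^2=I$ for all $i$; $A_iA_j=A_jA_i$ whenever $v_i,v_j$ occur in a common constraint; and, for each $s$, $c_s\big((A_i)_{i\in X_s}\big)=-I$, where $c_s$ is the unique real multilinear polynomial that represents the $s$-th constraint under the translation $V_i=(-1)^{v_i}$ (so that the value $-1$ means "satisfied"). Theorem. Suppose that the game of a BCS has a perfect quantum strategy using finite or countably-infinite dimensional entanglement $\psi=\sum_{i\in I}\alpha_i\,\phi_i\otimes\chi_i$ as above. Then the BCS has a quantum satisfying assignment. Moreover, for each $i_0\in I$ the block $B=\{i\in I:\alpha_i=\alpha_{i_0}\}$ of its Schmidt coefficient is finite, and: 1. There is a quantum satisfying assignment $A_1,\dots,A_n$ on $\operatorname{span}\{\phi_i: i\in B\}$ such that, for every constraint $s$ and every $x\in X_s$, $A_x$ is the restriction to this subspace of Alice's observable $\sum_a(-1)^{a_x}E^s_a$; in particular these observables leave the subspace invariant. 2. The strategy with the same POVMs and with $\psi$ replaced by the maximally entangled state $|B|^{-1/2}\sum_{i\in B}\phi_i\otimes\chi_i$ is again perfect. -/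

import Mathlib

open scoped TensorProduct InnerProductSpace

universe u v w

noncomputable section

/-- A binary constraint system on the variables `v_i`, `i : Fin n`, with `m` constraints.
The `s`-th constraint is a Boolean-valued function of a nonempty subset `vars s` of the variables;
a truth assignment `a` to these variables satisfies it when `constraint s a = true`. -/
structure BCS (n m : ℕ) where
  vars : Fin m → Finset (Fin n)
  vars_nonempty : ∀ s, (vars s).Nonempty
  constraint : (s : Fin m) → (vars s → Bool) → Bool

/-- The translation `b ↦ (-1)^b` of `{0,1}`-values into `{+1,-1}`-values. -/
def boolSign (b : Bool) : ℝ := if b then -1 else 1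

/-- A positive operator valued measure with finitely many outcomes on a Hilbert space.
Projective measurements are the special case in which every `op k` is a projection. -/
structure POVM (κ : Type*) [Fintype κ] (H : Type*) [NormedAddCommGroup H]
    [InnerProductSpace ℂ H] [CompleteSpace H] where
  op : κ → H →L[ℂ] H
  isPositive : ∀ k, (op k).IsPositive
  sum_op : ∑ k, op k = 1

/-- The Hilbert space tensor product: the completion of the algebraic tensor product. -/
abbrev HilbertTensor (HA : Type*) (HB : Type*)
    [NormedAddCommGroup HA] [InnerProductSpace ℂ HA]
    [NormedAddCommGroup HB] [InnerProductSpace ℂ HB] : Type _ :=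
  UniformSpace.Completion (HA ⊗[ℂ] HB)

/-- The elementary tensor `x ⊗ y` in the Hilbert space tensor product. -/
def hilbertTmul {HA : Type*} {HB : Type*}
    [NormedAddCommGroup HA] [InnerProductSpace ℂ HA]
    [NormedAddCommGroup HB] [InnerProductSpace ℂ HB] (x : HA) (y : HB) : HilbertTensor HA HB :=
  ((x ⊗ₜ[ℂ] y : HA ⊗[ℂ] HB) : UniformSpace.Completion (HA ⊗[ℂ] HB))

/-- The bounded operator `E ⊗ F` on the Hilbert space tensor product. -/
def hilbertMap {HA : Type*} {HB : Type*}
    [NormedAddCommGroup HA] [InnerProductSpace ℂ HA]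
    [NormedAddCommGroup HB] [InnerProductSpace ℂ HB]
    (E : HA →L[ℂ] HA) (F : HB →L[ℂ] HB) : HilbertTensor HA HB →L[ℂ] HilbertTensor HA HB :=
  (TensorProduct.mapL E F).completion

/-- `ψ = ∑ i, α i • (φ i ⊗ χ i)` with `α i > 0` and with orthonormal families `φ` and `χ`,
which need not be complete. -/
structure IsSchmidtForm {ι : Type*} {HA : Type*} {HB : Type*}
    [NormedAddCommGroup HA] [InnerProductSpace ℂ HA]
    [NormedAddCommGroup HB] [InnerProductSpace ℂ HB]
    (ψ : HilbertTensor HA HB) (α : ι → ℝ) (φ : ι → HA) (χ : ι → HB) : Prop where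
  pos : ∀ i, 0 < α i
  left : Orthonormal ℂ φ
  right : Orthonormal ℂ χ
  hasSum : HasSum (fun i => (α i : ℂ) • hilbertTmul (φ i) (χ i)) ψ

namespace BCS

variable {n m : ℕ}

/-- A quantum strategy for the game of a binary constraint system: a shared unit vector, for each
constraint `s` a measurement of Alice whose outcomes are the truth assignments to the variables of
`s`, and for each variable `t` a two-outcome measurement of Bob. -/
structure Strategy (G : BCS n m) (HA : Type u) (HB : Type v)
    [NormedAddCommGroup HA] [InnerProductSpace ℂ HA] [CompleteSpace HA]
    [NormedAddCommGroup HB] [InnerProductSpace ℂ HB] [CompleteSpace HB] where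
  state : HilbertTensor HA HB
  norm_state : ‖state‖ = 1
  alice : (s : Fin m) → POVM (G.vars s → Bool) HA
  bob : Fin n → POVM Bool HB

namespace Strategy

variable {G : BCS n m} {HA : Type u} {HB : Type v}
  [NormedAddCommGroup HA] [InnerProductSpace ℂ HA] [CompleteSpace HA]
  [NormedAddCommGroup HB] [InnerProductSpace ℂ HB] [CompleteSpace HB]

/-- The probability that Alice answers `a` and Bob answers `b` to the questions `s` and `t`. -/
def prob (S : G.Strategy HA HB) (s : Fin m) (t : Fin n) (a : G.vars s → Bool) (b : Bool) : ℝ :=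
  (⟪S.state, hilbertMap ((S.alice s).op a) ((S.bob t).op b) S.state⟫_ℂ).re

/-- The probability that the verifier accepts, given the questions `s` and `t`: Alice's assignment
has to satisfy the constraint, and Bob's value of `t` has to agree with Alice's. -/
def acceptProb (S : G.Strategy HA HB) (s : Fin m) (t : G.vars s) : ℝ :=
  ∑ a : G.vars s → Bool, ∑ b : Bool,
    if G.constraint s a = true ∧ b = a t then S.prob s t a b else 0

/-- A strategy is perfect if it always succeeds: for every pair of questions that the verifier can
ask (a constraint and one of its variables), the verifier accepts with probability one. -/
def IsPerfect (S : G.Strategy HA HB) : Prop :=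
  ∀ (s : Fin m) (t : G.vars s), S.acceptProb s t = 1

/-- Alice's `±1`-valued observable `∑ a, (-1)^(a x) E_a` for the variable `x` in the context of the
constraint `s`. -/
def aliceObservable (S : G.Strategy HA HB) (s : Fin m) (x : G.vars s) : HA →L[ℂ] HA :=
  ∑ a : G.vars s → Bool, (boolSign (a x) : ℂ) • (S.alice s).op a

end Strategy

/-- The multilinear polynomial `∑ T, p T * ∏ i ∈ T, V i` represents the `s`-th constraint, regarded
as a function `{+1,-1}^k → {+1,-1}` with `-1` for "satisfied" (`true`). There is exactly one such
family of coefficients `p`. -/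
def IsMultilinearRep (G : BCS n m) (s : Fin m) (p : Finset (G.vars s) → ℝ) : Prop :=
  ∀ a : G.vars s → Bool,
    ∑ T : Finset (G.vars s), p T * ∏ i ∈ T, boolSign (a i) = boolSign (G.constraint s a)

/-- The value of the multilinear polynomial with coefficients `p` at operators `A i`. The factors
of a monomial are multiplied in increasing order of the variables (the order is irrelevant for
commuting operators). -/
def evalMultilinear (G : BCS n m) (s : Fin m) (p : Finset (G.vars s) → ℝ)
    {H : Type*} [NormedAddCommGroup H] [InnerProductSpace ℂ H] (A : G.vars s → H →ₗ[ℂ] H) :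
    H →ₗ[ℂ] H :=
  ∑ T : Finset (G.vars s), (p T : ℂ) • ((T.sort (· ≤ ·)).map A).prod

/-- The operators `A i` on the nonzero finite-dimensional Hilbert space `H` form a quantum
satisfying assignment: they are binary observables, those of a common constraint commute, and each
constraint polynomial takes the value `-I`. -/
structure IsQuantumSatisfyingAssignment (G : BCS n m)
    {H : Type*} [NormedAddCommGroup H] [InnerProductSpace ℂ H] (A : Fin n → H →ₗ[ℂ] H) : Prop where
  finiteDimensional : FiniteDimensional ℂ H
  nontrivial : Nontrivial H
  isSymmetric : ∀ i, (A i).IsSymmetric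
  sq_eq_one : ∀ i, A i * A i = 1
  commute : ∀ s, ∀ i ∈ G.vars s, ∀ j ∈ G.vars s, A i * A j = A j * A i
  satisfies : ∀ s, ∃ p : Finset (G.vars s) → ℝ, G.IsMultilinearRep s p ∧
    G.evalMultilinear s p (fun i => A i) = -1

/-- There is a quantum satisfying assignment, by operators on some `ℂ^d`. -/
def HasQuantumSatisfyingAssignment (G : BCS n m) : Prop :=
  ∃ (d : ℕ) (A : Fin n → EuclideanSpace ℂ (Fin d) →ₗ[ℂ] EuclideanSpace ℂ (Fin d)),
    G.IsQuantumSatisfyingAssignment A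

end BCS

/-- The set of indices whose Schmidt coefficient equals that of `i₀`. -/
def schmidtBlock {ι : Type*} (α : ι → ℝ) (i₀ : ι) : Set ι := {i | α i = α i₀}

/-- The vector `d^(-1/2) ∑ i ∈ B, φ i ⊗ χ i`, where `d` is the number of elements of `B`; for
orthonormal `φ`, `χ` and nonempty `B` it is a `d`-dimensional maximally entangled state. -/
def maxEntangled {ι : Type*} {HA : Type*} {HB : Type*}
    [NormedAddCommGroup HA] [InnerProductSpace ℂ HA]
    [NormedAddCommGroup HB] [InnerProductSpace ℂ HB]
    (B : Finset ι) (φ : ι → HA) (χ : ι → HB) : HilbertTensor HA HB :=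
  (((Real.sqrt B.card)⁻¹ : ℝ) : ℂ) • ∑ i ∈ B, hilbertTmul (φ i) (χ i)

end

/-! Perfection makes every rejected answer pair have probability zero, and a positive operator with
zero expectation annihilates the state ψ (`acceptProb_eq_one_iff`). Since Bob has two outcomes, this
gives (E_a ⊗ B_t)ψ = (-1)^(a_t) (E_a ⊗ 1)ψ for his observable B_t, and summing over a, (A_x ⊗ 1)ψ =
(1 ⊗ B_x)ψ. The right side does not involve the constraint, so on the Schmidt vectors A_x does not
either.

Comparing matrix elements in this relation and using Hermiticity yields (α_j² - α_i²)⟨φ_i, A_x φ_j⟩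
= 0. Hence A_x preserves the span of each Schmidt block (`apply_mem_span`), which is
finite-dimensional because α_i → 0.

On the Schmidt vectors E_a A_x = (-1)^(a_x) E_a, even though the E_a need not be projections. As the
E_a sum to 1, an operator identity on the block can be checked after applying each E_a, where it
becomes an identity of signs (`alice_blockAssignment`, `POVM.ext_apply`).

Projecting Alice's side of ψ onto a block gives a multiple of the maximally entangled state; the
projection commutes with A_x, so the relation with B_x survives. -/

/-! ### Operators on the Hilbert space tensor product -/

section HilbertTensor

variable {HA : Type*} {HB : Type*}
  [NormedAddCommGroup HA] [InnerProductSpace ℂ HA]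
  [NormedAddCommGroup HB] [InnerProductSpace ℂ HB]

@[simp] theorem hilbertMap_tmul (E : HA →L[ℂ] HA) (F : HB →L[ℂ] HB) (x : HA) (y : HB) :
    hilbertMap E F (hilbertTmul x y) = hilbertTmul (E x) (F y) := by
  simp [hilbertMap, hilbertTmul]

@[simp] theorem inner_hilbertTmul (x x' : HA) (y y' : HB) :
    ⟪hilbertTmul x y, hilbertTmul x' y'⟫_ℂ = ⟪x, x'⟫_ℂ * ⟪y, y'⟫_ℂ := by
  simp [hilbertTmul, UniformSpace.Completion.inner_coe]

@[simp] theorem norm_hilbertTmul (x : HA) (y : HB) : ‖hilbertTmul x y‖ = ‖x‖ * ‖y‖ := by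
  simp [hilbertTmul]

theorem hilbertTensor_coe_zero : ((0 : HA ⊗[ℂ] HB) : HilbertTensor HA HB) = 0 := rfl

theorem hilbertTensor_coe_add (a b : HA ⊗[ℂ] HB) :
    ((a + b : HA ⊗[ℂ] HB) : HilbertTensor HA HB) = a + b :=
  UniformSpace.Completion.coe_add a b

theorem hilbertTensor_coe_smul (c : ℂ) (a : HA ⊗[ℂ] HB) :
    ((c • a : HA ⊗[ℂ] HB) : HilbertTensor HA HB) = c • (a : HilbertTensor HA HB) :=
  UniformSpace.Completion.coe_smul c a

theorem hilbertTmul_add_left (x x' : HA) (y : HB) :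
    hilbertTmul (x + x') y = hilbertTmul x y + hilbertTmul x' y := by
  simp only [hilbertTmul, TensorProduct.add_tmul, hilbertTensor_coe_add]

theorem hilbertTmul_add_right (x : HA) (y y' : HB) :
    hilbertTmul x (y + y') = hilbertTmul x y + hilbertTmul x y' := by
  simp only [hilbertTmul, TensorProduct.tmul_add, hilbertTensor_coe_add]

theorem hilbertTmul_smul_left (c : ℂ) (x : HA) (y : HB) :
    hilbertTmul (c • x) y = c • hilbertTmul x y := by
  simp only [hilbertTmul, ← TensorProduct.smul_tmul', hilbertTensor_coe_smul]

theorem hilbertTmul_smul_right (c : ℂ) (x : HA) (y : HB) :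
    hilbertTmul x (c • y) = c • hilbertTmul x y := by
  simp only [hilbertTmul, TensorProduct.tmul_smul, hilbertTensor_coe_smul]

@[simp] theorem hilbertTmul_zero_left (y : HB) : hilbertTmul (0 : HA) y = 0 := by
  simpa using hilbertTmul_smul_left 0 (0 : HA) y

/-- Two bounded operators that agree on the elementary tensors are equal. -/
theorem hilbertTensor_ext {T T' : HilbertTensor HA HB →L[ℂ] HilbertTensor HA HB}
    (h : ∀ x y, T (hilbertTmul x y) = T' (hilbertTmul x y)) : T = T' := by
  ext z
  induction z using UniformSpace.Completion.induction_on with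
  | hp => exact isClosed_eq T.continuous T'.continuous
  | ih a =>
    induction a using TensorProduct.induction_on with
    | zero => simp only [hilbertTensor_coe_zero, map_zero]
    | tmul x y => exact h x y
    | add a b ha hb => simp only [hilbertTensor_coe_add, map_add, ha, hb]

theorem hilbertMap_mul (E E' : HA →L[ℂ] HA) (F F' : HB →L[ℂ] HB) :
    hilbertMap (E * E') (F * F') = hilbertMap E F * hilbertMap E' F' :=
  hilbertTensor_ext fun x y => by simp

@[simp] theorem hilbertMap_one : hilbertMap (1 : HA →L[ℂ] HA) (1 : HB →L[ℂ] HB) = 1 :=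
  hilbertTensor_ext fun x y => by simp

/-- The operator `E ⊗ F` depends bilinearly on `E` and `F`. -/
noncomputable def hilbertMapBilinear (HA : Type*) (HB : Type*)
    [NormedAddCommGroup HA] [InnerProductSpace ℂ HA]
    [NormedAddCommGroup HB] [InnerProductSpace ℂ HB] :
    (HA →L[ℂ] HA) →ₗ[ℂ] (HB →L[ℂ] HB) →ₗ[ℂ]
      (HilbertTensor HA HB →L[ℂ] HilbertTensor HA HB) :=
  LinearMap.mk₂ ℂ hilbertMap
    (fun E E' F => hilbertTensor_ext fun x y => by
      simp [hilbertTmul_add_left])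
    (fun c E F => hilbertTensor_ext fun x y => by
      simp [hilbertTmul_smul_left])
    (fun E F F' => hilbertTensor_ext fun x y => by
      simp [hilbertTmul_add_right])
    (fun c E F => hilbertTensor_ext fun x y => by
      simp [hilbertTmul_smul_right])

theorem hilbertMapBilinear_apply (E : HA →L[ℂ] HA) (F : HB →L[ℂ] HB) :
    hilbertMapBilinear HA HB E F = hilbertMap E F := rfl

theorem hilbertMap_sum_smul_left {κ : Type*} (s : Finset κ) (c : κ → ℂ) (E : κ → HA →L[ℂ] HA)
    (F : HB →L[ℂ] HB) :
    hilbertMap (∑ k ∈ s, c k • E k) F = ∑ k ∈ s, c k • hilbertMap (E k) F := by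
  simp only [← hilbertMapBilinear_apply, map_sum, map_smul, LinearMap.sum_apply,
    LinearMap.smul_apply]

theorem hilbertMap_sum_smul_right {κ : Type*} (s : Finset κ) (c : κ → ℂ) (E : HA →L[ℂ] HA)
    (F : κ → HB →L[ℂ] HB) :
    hilbertMap E (∑ k ∈ s, c k • F k) = ∑ k ∈ s, c k • hilbertMap E (F k) := by
  simp only [← hilbertMapBilinear_apply, map_sum, map_smul]

theorem hilbertMap_sum_left {κ : Type*} (s : Finset κ) (E : κ → HA →L[ℂ] HA)
    (F : HB →L[ℂ] HB) :
    hilbertMap (∑ k ∈ s, E k) F = ∑ k ∈ s, hilbertMap (E k) F := by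
  simpa using hilbertMap_sum_smul_left s 1 E F

theorem hilbertMap_sum_right {κ : Type*} (s : Finset κ) (E : HA →L[ℂ] HA)
    (F : κ → HB →L[ℂ] HB) :
    hilbertMap E (∑ k ∈ s, F k) = ∑ k ∈ s, hilbertMap E (F k) := by
  simpa using hilbertMap_sum_smul_right s 1 E F

variable [CompleteSpace HA] [CompleteSpace HB]

theorem inner_hilbertMap_left (E : HA →L[ℂ] HA) (F : HB →L[ℂ] HB) (z w : HilbertTensor HA HB) :
    ⟪hilbertMap E F z, w⟫_ℂ = ⟪z, hilbertMap (star E) (star F) w⟫_ℂ := by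
  -- Density is used in one argument at a time: with an elementary tensor on the left, both sides
  -- are continuous linear functionals of the right argument.
  have h (x : HA) (y : HB) : (innerSL ℂ (hilbertMap E F (hilbertTmul x y))) =
      (innerSL ℂ (hilbertTmul x y)) ∘L hilbertMap (star E) (star F) := by
    ext w
    induction w using UniformSpace.Completion.induction_on with
    | hp => exact isClosed_eq (ContinuousLinearMap.continuous _) (ContinuousLinearMap.continuous _)
    | ih a =>
      induction a using TensorProduct.induction_on with
      | zero => simp only [hilbertTensor_coe_zero, map_zero]
      | tmul x' y' =>
        change ⟪hilbertMap E F (hilbertTmul x y), hilbertTmul x' y'⟫_ℂ =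
          ⟪hilbertTmul x y, hilbertMap (star E) (star F) (hilbertTmul x' y')⟫_ℂ
        simp [ContinuousLinearMap.star_eq_adjoint, ContinuousLinearMap.adjoint_inner_right]
      | add a b ha hb => simp only [hilbertTensor_coe_add, map_add, ha, hb]
  induction z using UniformSpace.Completion.induction_on with
  | hp => exact isClosed_eq (by fun_prop) (by fun_prop)
  | ih a =>
    induction a using TensorProduct.induction_on with
    | zero => simp only [hilbertTensor_coe_zero, map_zero, inner_zero_left]
    | tmul x y => exact congr($(h x y) w)
    | add a b ha hb =>
      simp only [hilbertTensor_coe_add, map_add, inner_add_left, ha, hb]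

/-- A product of positive operators `E ⊗ F` is a square `star T * T`. -/
theorem exists_hilbertMap_inner_eq_norm_sq {E : HA →L[ℂ] HA} {F : HB →L[ℂ] HB}
    (hE : E.IsPositive) (hF : F.IsPositive) :
    ∃ (X : HA →L[ℂ] HA) (Y : HB →L[ℂ] HB), hilbertMap E F =
        hilbertMap (star X) (star Y) * hilbertMap X Y ∧
      ∀ z, ⟪z, hilbertMap E F z⟫_ℂ = ((‖hilbertMap X Y z‖ ^ 2 : ℝ) : ℂ) := by
  obtain ⟨X, rfl⟩ := CStarAlgebra.nonneg_iff_eq_star_mul_self.mp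
    ((ContinuousLinearMap.nonneg_iff_isPositive E).mpr hE)
  obtain ⟨Y, rfl⟩ := CStarAlgebra.nonneg_iff_eq_star_mul_self.mp
    ((ContinuousLinearMap.nonneg_iff_isPositive F).mpr hF)
  refine ⟨X, Y, hilbertMap_mul _ _ _ _, fun z => ?_⟩
  rw [hilbertMap_mul, mul_apply_eq_comp, ← inner_hilbertMap_left,
    inner_self_eq_norm_sq_to_K]
  simp

theorem re_inner_hilbertMap_nonneg {E : HA →L[ℂ] HA} {F : HB →L[ℂ] HB}
    (hE : E.IsPositive) (hF : F.IsPositive) (z : HilbertTensor HA HB) :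
    0 ≤ (⟪z, hilbertMap E F z⟫_ℂ).re := by
  obtain ⟨X, Y, -, h⟩ := exists_hilbertMap_inner_eq_norm_sq hE hF
  rw [h, Complex.ofReal_re]
  positivity

/-- Writing E ⊗ F = T*T, zero expectation means Tz = 0. This turns a vanishing probability into a
vector equation. -/
theorem hilbertMap_eq_zero_of_re_inner_eq_zero {E : HA →L[ℂ] HA} {F : HB →L[ℂ] HB}
    (hE : E.IsPositive) (hF : F.IsPositive) {z : HilbertTensor HA HB}
    (hz : (⟪z, hilbertMap E F z⟫_ℂ).re = 0) : hilbertMap E F z = 0 := by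
  obtain ⟨X, Y, hXY, h⟩ := exists_hilbertMap_inner_eq_norm_sq hE hF
  rw [h, Complex.ofReal_re] at hz
  have h0 : hilbertMap X Y z = 0 := by simpa using hz
  rw [hXY, mul_apply_eq_comp, h0, map_zero]

end HilbertTensor

/-! ### Schmidt decompositions and Schmidt blocks -/

namespace IsSchmidtForm

variable {ι : Type*} {HA : Type*} {HB : Type*}
  [NormedAddCommGroup HA] [InnerProductSpace ℂ HA]
  [NormedAddCommGroup HB] [InnerProductSpace ℂ HB]
  {ψ : HilbertTensor HA HB} {α : ι → ℝ} {φ : ι → HA} {χ : ι → HB}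

theorem hasSum_hilbertMap (h : IsSchmidtForm ψ α φ χ) (E : HA →L[ℂ] HA) (F : HB →L[ℂ] HB) :
    HasSum (fun i => (α i : ℂ) • hilbertTmul (E (φ i)) (F (χ i))) (hilbertMap E F ψ) := by
  simpa only [map_smul, hilbertMap_tmul] using (hilbertMap E F).hasSum h.hasSum

theorem hasSum_inner (h : IsSchmidtForm ψ α φ χ) (E : HA →L[ℂ] HA) (F : HB →L[ℂ] HB)
    (x : HA) (y : HB) :
    HasSum (fun i => (α i : ℂ) * (⟪x, E (φ i)⟫_ℂ * ⟪y, F (χ i)⟫_ℂ))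
      ⟪hilbertTmul x y, hilbertMap E F ψ⟫_ℂ := by
  simpa [inner_smul_right] using
    (innerSL ℂ (hilbertTmul x y)).hasSum (h.hasSum_hilbertMap E F)

/-- Orthonormality of χ leaves only the j-th term, so vector equations at ψ can be read as equations
between matrix elements. -/
theorem inner_hilbertMap_one_right (h : IsSchmidtForm ψ α φ χ) (E : HA →L[ℂ] HA) (x : HA)
    (j : ι) : ⟪hilbertTmul x (χ j), hilbertMap E 1 ψ⟫_ℂ = α j * ⟪x, E (φ j)⟫_ℂ := by
  refine (h.hasSum_inner E 1 x (χ j)).unique ?_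
  convert hasSum_single j fun i hij => ?_ using 1
  · simp [h.right.1 j]
  · simp [h.right.2 hij.symm]

theorem inner_hilbertMap_one_left (h : IsSchmidtForm ψ α φ χ) (F : HB →L[ℂ] HB) (y : HB)
    (j : ι) : ⟪hilbertTmul (φ j) y, hilbertMap 1 F ψ⟫_ℂ = α j * ⟪y, F (χ j)⟫_ℂ := by
  refine (h.hasSum_inner 1 F (φ j) y).unique ?_
  convert hasSum_single j fun i hij => ?_ using 1
  · simp [h.left.1 j]
  · simp [h.left.2 hij.symm]

theorem ne_zero (h : IsSchmidtForm ψ α φ χ) (i : ι) : (α i : ℂ) ≠ 0 :=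
  Complex.ofReal_ne_zero.mpr (h.pos i).ne'

/-- Operators `E ⊗ 1` with the same value at `ψ` agree on the Schmidt vectors. -/
theorem apply_eq_of_hilbertMap_eq (h : IsSchmidtForm ψ α φ χ) {E E' : HA →L[ℂ] HA}
    (hE : hilbertMap E 1 ψ = hilbertMap E' 1 ψ) (j : ι) : E (φ j) = E' (φ j) := by
  refine ext_inner_left ℂ fun x => mul_left_cancel₀ (h.ne_zero j) ?_
  rw [← h.inner_hilbertMap_one_right, ← h.inner_hilbertMap_one_right, hE]

theorem nonempty (h : IsSchmidtForm ψ α φ χ) (hψ : ψ ≠ 0) : Nonempty ι := by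
  by_contra hι
  rw [not_nonempty_iff] at hι
  exact hψ (h.hasSum.unique hasSum_empty)

/-- α_i is the norm of the i-th term of a summable family, hence tends to 0 along the cofinite
filter; only finitely many α_i can reach α_{i₀}. -/
theorem finite_schmidtBlock (h : IsSchmidtForm ψ α φ χ) (i₀ : ι) :
    (schmidtBlock α i₀).Finite := by
  have ht := h.hasSum.summable.tendsto_cofinite_zero.norm
  have hn (i : ι) : ‖(α i : ℂ) • hilbertTmul (φ i) (χ i)‖ = α i := by
    rw [norm_smul, norm_hilbertTmul, h.left.1, h.right.1, Complex.norm_real]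
    simp [abs_of_pos (h.pos i)]
  simp only [hn, norm_zero] at ht
  have := (ht.eventually_lt_const (h.pos i₀))
  rw [Filter.eventually_cofinite] at this
  exact this.subset fun i (hi : α i = α i₀) => by simp [hi]

/-- If Hermitian `A` and `B` satisfy `(A ⊗ 1) ψ = (1 ⊗ B) ψ` then `A` has no matrix elements
between different Schmidt blocks. -/
theorem inner_eq_zero_of_ne (h : IsSchmidtForm ψ α φ χ) {A : HA →L[ℂ] HA} {B : HB →L[ℂ] HB}
    (hA : (A : HA →ₗ[ℂ] HA).IsSymmetric) (hB : (B : HB →ₗ[ℂ] HB).IsSymmetric)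
    (hAB : hilbertMap A 1 ψ = hilbertMap 1 B ψ)
    {i j : ι} (hij : α i ≠ α j) : ⟪φ i, A (φ j)⟫_ℂ = 0 := by
  have key (i j : ι) : (α j : ℂ) * ⟪φ i, A (φ j)⟫_ℂ = α i * ⟪χ j, B (χ i)⟫_ℂ := by
    rw [← h.inner_hilbertMap_one_right, hAB, h.inner_hilbertMap_one_left]
  -- The relation `key` with i and j exchanged, then conjugated; Hermiticity returns the same two
  -- matrix elements with the coefficients swapped.
  have key' : (α i : ℂ) * ⟪φ i, A (φ j)⟫_ℂ = α j * ⟪χ j, B (χ i)⟫_ℂ := by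
    have := congr(starRingEnd ℂ $(key j i))
    rw [map_mul, map_mul, Complex.conj_ofReal, Complex.conj_ofReal, inner_conj_symm,
      inner_conj_symm] at this
    have e1 := hA (φ i) (φ j)
    have e2 := hB (χ j) (χ i)
    simp only [ContinuousLinearMap.coe_coe] at e1 e2
    rwa [e1, e2] at this
  have h1 : ((α j : ℂ) * α j - α i * α i) * ⟪φ i, A (φ j)⟫_ℂ = 0 := by
    linear_combination (α j : ℂ) * key i j - (α i : ℂ) * key'
  refine (mul_eq_zero.mp h1).resolve_left fun h2 => hij ?_
  have h3 : α j * α j = α i * α i := by exact_mod_cast sub_eq_zero.mp h2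
  nlinarith [h.pos i, h.pos j]

/-- Under the same hypotheses `A` leaves the span of every Schmidt block invariant. -/
theorem apply_mem_span (h : IsSchmidtForm ψ α φ χ) {A : HA →L[ℂ] HA} {B : HB →L[ℂ] HB}
    (hA : (A : HA →ₗ[ℂ] HA).IsSymmetric) (hB : (B : HB →ₗ[ℂ] HB).IsSymmetric)
    (hAB : hilbertMap A 1 ψ = hilbertMap 1 B ψ) (i₀ : ι) {v : HA}
    (hv : v ∈ Submodule.span ℂ (φ '' schmidtBlock α i₀)) :
    A v ∈ Submodule.span ℂ (φ '' schmidtBlock α i₀) := by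
  have : FiniteDimensional ℂ (Submodule.span ℂ (φ '' schmidtBlock α i₀)) :=
    FiniteDimensional.span_of_finite ℂ ((h.finite_schmidtBlock i₀).image φ)
  refine Submodule.span_induction ?_ (by simp) (fun x y _ _ hx hy => ?_)
    (fun c x _ hx => ?_) hv
  · rintro _ ⟨j, hj, rfl⟩
    -- φ need not be complete, so vanishing matrix elements between Schmidt vectors do not suffice:
    -- A φ_j is tested against every x orthogonal to the block.
    rw [← Submodule.orthogonal_orthogonal (Submodule.span ℂ (φ '' schmidtBlock α i₀)),
      Submodule.mem_orthogonal]
    intro x hx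
    refine (mul_eq_zero.mp ?_).resolve_left (h.ne_zero j)
    rw [← h.inner_hilbertMap_one_right, hAB]
    refine (h.hasSum_inner 1 B x (χ j)).unique ?_
    convert hasSum_zero with i
    -- Inside the block x is orthogonal to φ_i; outside it ⟨χ_j, B χ_i⟩ vanishes, being a multiple
    -- of ⟨φ_i, A φ_j⟩.
    by_cases hi : α i = α i₀
    · have : ⟪x, φ i⟫_ℂ = 0 := Submodule.inner_left_of_mem_orthogonal
        (Submodule.subset_span (Set.mem_image_of_mem φ hi)) hx
      simp [this]
    · have hne : α i ≠ α j := fun e => hi (e.trans hj)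
      have h1 := h.inner_hilbertMap_one_left B (χ j) i
      rw [← hAB, h.inner_hilbertMap_one_right, h.inner_eq_zero_of_ne hA hB hAB hne,
        mul_zero] at h1
      rw [mul_left_comm, one_apply_eq_self, ← h1, mul_zero]
  · rw [map_add]; exact add_mem hx hy
  · rw [map_smul]; exact Submodule.smul_mem _ c hx

end IsSchmidtForm

/-! ### Signs and multilinear polynomials -/

theorem boolSign_mul_self (b : Bool) : boolSign b * boolSign b = 1 := by
  cases b <;> simp [boolSign]

theorem boolSign_mul_of_ne {a b : Bool} (h : a ≠ b) : boolSign a * boolSign b = -1 := by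
  cases a <;> cases b <;> simp_all [boolSign]

theorem Finset.list_prod_map_sort {ι M : Type*} [LinearOrder ι] [CommMonoid M] (T : Finset ι)
    (f : ι → M) : ((T.sort (· ≤ ·)).map f).prod = ∏ i ∈ T, f i := by
  rw [Finset.prod, ← Finset.sort_eq T (· ≤ ·), Multiset.map_coe, Multiset.prod_coe]

/-- Every real function of finitely many signs is a multilinear polynomial. -/
theorem exists_multilinear_eq {ι : Type*} [Fintype ι] [DecidableEq ι] (f : (ι → Bool) → ℝ) :
    ∃ p : Finset ι → ℝ, ∀ a : ι → Bool, ∑ T : Finset ι, p T * ∏ i ∈ T, boolSign (a i) = f a := by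
  -- The Walsh–Fourier coefficients of f.
  refine ⟨fun T => ∑ b : ι → Bool,
    f b * (2⁻¹ ^ Fintype.card ι * ∏ i ∈ T, boolSign (b i)), fun a => ?_⟩
  -- Orthogonality of characters: the sum over T factors as ∏ (1 + b_i a_i), which has a zero factor
  -- wherever the signs differ.
  have h (b : ι → Bool) : ∑ T : Finset ι, ∏ i ∈ T, boolSign (b i) * boolSign (a i) =
      if b = a then 2 ^ Fintype.card ι else 0 := by
    have := Finset.prod_one_add (f := fun i => boolSign (b i) * boolSign (a i)) Finset.univ
    rw [Finset.powerset_univ] at this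
    rw [← this]
    split_ifs with hb
    · subst hb
      simp [boolSign_mul_self, one_add_one_eq_two]
    · obtain ⟨i, hi⟩ := Function.ne_iff.mp hb
      exact Finset.prod_eq_zero (Finset.mem_univ i) (by rw [boolSign_mul_of_ne hi]; norm_num)
  calc _ = ∑ b : ι → Bool, f b * (2⁻¹ ^ Fintype.card ι *
        ∑ T : Finset ι, ∏ i ∈ T, boolSign (b i) * boolSign (a i)) := by
        simp only [Finset.sum_mul, Finset.mul_sum, Finset.prod_mul_distrib]
        rw [Finset.sum_comm]
        simp only [mul_assoc]
    _ = f a := by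
        simp only [h, mul_ite, mul_zero, Finset.sum_ite_eq', Finset.mem_univ, if_true]
        rw [inv_pow, inv_mul_cancel₀ (by positivity), mul_one]

/-! ### Unitary invariance of quantum satisfying assignments -/

namespace BCS

variable {n m : ℕ} {G : BCS n m}

theorem IsQuantumSatisfyingAssignment.conj {H H' : Type*} [NormedAddCommGroup H]
    [InnerProductSpace ℂ H] [NormedAddCommGroup H'] [InnerProductSpace ℂ H']
    {A : Fin n → H →ₗ[ℂ] H} (hA : G.IsQuantumSatisfyingAssignment A) (e : H ≃ₗᵢ[ℂ] H') :
    G.IsQuantumSatisfyingAssignment fun i => e.toLinearEquiv.conjAlgEquiv ℂ (A i) := by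
  have := hA.finiteDimensional
  have := hA.nontrivial
  refine ⟨e.toLinearEquiv.finiteDimensional, e.symm.toEquiv.nontrivial, fun i x y => ?_,
    fun i => ?_, fun s i hi j hj => ?_, fun s => ?_⟩
  · have h := hA.isSymmetric i (e.symm x) (e.symm y)
    have h1 : ⟪e (A i (e.symm x)), e (e.symm y)⟫_ℂ = ⟪e (e.symm x), e (A i (e.symm y))⟫_ℂ := by
      rw [e.inner_map_map, e.inner_map_map, h]
    simpa using h1
  · rw [← map_mul, hA.sq_eq_one, map_one]
  · rw [← map_mul, hA.commute s i hi j hj, map_mul]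
  · obtain ⟨p, hp, h⟩ := hA.satisfies s
    refine ⟨p, hp, ?_⟩
    have h1 := congr(e.toLinearEquiv.conjAlgEquiv ℂ $h)
    rw [map_neg, map_one] at h1
    rw [← h1]
    simp only [evalMultilinear, map_sum, map_smul, map_list_prod, List.map_map]
    rfl

theorem IsQuantumSatisfyingAssignment.hasQuantumSatisfyingAssignment {H : Type*}
    [NormedAddCommGroup H] [InnerProductSpace ℂ H] {A : Fin n → H →ₗ[ℂ] H}
    (hA : G.IsQuantumSatisfyingAssignment A) : G.HasQuantumSatisfyingAssignment :=
  have := hA.finiteDimensional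
  ⟨_, _, hA.conj (stdOrthonormalBasis ℂ H).repr⟩

end BCS

/-! ### Generalities on measurements -/

theorem POVM.isSymmetric_sum_real_smul {κ H : Type*} [Fintype κ] [NormedAddCommGroup H]
    [InnerProductSpace ℂ H] [CompleteSpace H] (P : POVM κ H) (c : κ → ℝ) :
    ((∑ k, (c k : ℂ) • P.op k : H →L[ℂ] H) : H →ₗ[ℂ] H).IsSymmetric := by
  intro x y
  simp only [ContinuousLinearMap.coe_coe, sum_apply,
    smul_apply, sum_inner, inner_sum, inner_smul_left, inner_smul_right,
    Complex.conj_ofReal]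
  exact Finset.sum_congr rfl fun k _ => congrArg _ ((P.isPositive k).isSymmetric x y)

/-- The effects sum to 1. This replaces projectivity: it reduces vector equations to their images
under each effect. -/
theorem POVM.ext_apply {κ H : Type*} [Fintype κ] [NormedAddCommGroup H]
    [InnerProductSpace ℂ H] [CompleteSpace H] (P : POVM κ H) {x y : H}
    (h : ∀ k, P.op k x = P.op k y) : x = y := by
  rw [← one_apply_eq_self (F := H →L[ℂ] H) x, ← one_apply_eq_self (F := H →L[ℂ] H) y,
    ← P.sum_op, sum_apply, sum_apply]
  exact Finset.sum_congr rfl fun k _ => h k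

/-- Operators that agree on a family agree on the spans of its subfamilies. -/
theorem ContinuousLinearMap.eq_of_mem_span_image {ι H : Type*} [NormedAddCommGroup H]
    [InnerProductSpace ℂ H] {φ : ι → H} {E E' : H →L[ℂ] H} (h : ∀ i, E (φ i) = E' (φ i)) {B : Set ι}
    {v : H} (hv : v ∈ Submodule.span ℂ (φ '' B)) : E v = E' v :=
  LinearMap.eqOn_span (f := (E : H →ₗ[ℂ] H)) (g := (E' : H →ₗ[ℂ] H))
    (by rintro _ ⟨i, -, rfl⟩; exact h i) hv

/-! ### Consequences of perfection -/

namespace BCS.Strategy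

variable {n m : ℕ} {G : BCS n m} {HA : Type u} {HB : Type v}
  [NormedAddCommGroup HA] [InnerProductSpace ℂ HA] [CompleteSpace HA]
  [NormedAddCommGroup HB] [InnerProductSpace ℂ HB] [CompleteSpace HB]
  (S : G.Strategy HA HB)

/-- Bob's `±1`-valued observable `∑ b, (-1)^b F_b` for the variable `t`. -/
noncomputable def bobObservable (t : Fin n) : HB →L[ℂ] HB :=
  ∑ b : Bool, (boolSign b : ℂ) • (S.bob t).op b

theorem isSymmetric_aliceObservable (s : Fin m) (x : G.vars s) :
    (S.aliceObservable s x : HA →ₗ[ℂ] HA).IsSymmetric :=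
  POVM.isSymmetric_sum_real_smul (S.alice s) fun a => boolSign (a x)

theorem isSymmetric_bobObservable (t : Fin n) :
    (S.bobObservable t : HB →ₗ[ℂ] HB).IsSymmetric :=
  POVM.isSymmetric_sum_real_smul (S.bob t) boolSign

theorem sum_prob (s : Fin m) (t : Fin n) : ∑ a, ∑ b, S.prob s t a b = 1 := by
  have h : ∑ a, ∑ b, hilbertMap ((S.alice s).op a) ((S.bob t).op b) = 1 := by
    simp only [← hilbertMap_sum_right, ← hilbertMap_sum_left, POVM.sum_op, hilbertMap_one]
  have h1 : ⟪S.state, S.state⟫_ℂ = 1 := by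
    rw [inner_self_eq_norm_sq_to_K, S.norm_state]; simp
  have h2 := congr(⟪S.state, $h S.state⟫_ℂ)
  simp only [sum_apply, inner_sum, one_apply_eq_self, h1] at h2
  have h3 := congr(Complex.re $h2)
  simpa only [prob, Complex.re_sum, Complex.one_re] using h3

/-- The verifier accepts with certainty exactly if the operators of the rejected pairs of answers
annihilate the state. -/
theorem acceptProb_eq_one_iff (s : Fin m) (t : G.vars s) :
    S.acceptProb s t = 1 ↔ ∀ a b, ¬ (G.constraint s a = true ∧ b = a t) →
      hilbertMap ((S.alice s).op a) ((S.bob t).op b) S.state = 0 := by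
  -- Total probability splits into accepted and rejected parts; the rejected terms are nonnegative,
  -- so they all vanish when acceptance is certain.
  have hsum : S.acceptProb s t + ∑ a, ∑ b,
      (if G.constraint s a = true ∧ b = a t then 0 else S.prob s t a b) = 1 := by
    rw [← S.sum_prob s t, acceptProb, ← Finset.sum_add_distrib]
    refine Finset.sum_congr rfl fun a _ => ?_
    rw [← Finset.sum_add_distrib]
    refine Finset.sum_congr rfl fun b _ => ?_
    split_ifs <;> simp
  have hpos (a : G.vars s → Bool) (b : Bool) :
      0 ≤ if G.constraint s a = true ∧ b = a t then 0 else S.prob s t a b := by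
    split_ifs
    · exact le_rfl
    · exact re_inner_hilbertMap_nonneg ((S.alice s).isPositive a) ((S.bob t).isPositive b) _
  constructor
  · intro h a b hab
    rw [h, add_eq_left, Finset.sum_eq_zero_iff_of_nonneg
      fun a _ => Finset.sum_nonneg fun b _ => hpos a b] at hsum
    have h1 := hsum a (Finset.mem_univ a)
    rw [Finset.sum_eq_zero_iff_of_nonneg fun b _ => hpos a b] at h1
    have h2 := h1 b (Finset.mem_univ b)
    rw [if_neg hab] at h2
    exact hilbertMap_eq_zero_of_re_inner_eq_zero ((S.alice s).isPositive a)
      ((S.bob t).isPositive b) h2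
  · intro h
    rw [← hsum, left_eq_add]
    refine Finset.sum_eq_zero fun a _ => Finset.sum_eq_zero fun b _ => ?_
    split_ifs with hab
    · rfl
    · simp [prob, h a b hab]

variable {S}

/-- Any variable of the constraint will do as Bob's question: each of his answers is rejected, and
his effects sum to 1. -/
theorem IsPerfect.hilbertMap_alice_eq_zero (hS : S.IsPerfect) (s : Fin m) {a : G.vars s → Bool}
    (ha : G.constraint s a ≠ true) : hilbertMap ((S.alice s).op a) 1 S.state = 0 := by
  obtain ⟨t, ht⟩ := G.vars_nonempty s
  rw [← (S.bob t).sum_op, hilbertMap_sum_right, sum_apply]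
  exact Finset.sum_eq_zero fun b _ =>
    (S.acceptProb_eq_one_iff s ⟨t, ht⟩).mp (hS s ⟨t, ht⟩) a b fun h => ha h.1

theorem IsPerfect.hilbertMap_alice_bobObservable (hS : S.IsPerfect) (s : Fin m) (t : G.vars s)
    (a : G.vars s → Bool) : hilbertMap ((S.alice s).op a) (S.bobObservable t) S.state =
      (boolSign (a t) : ℂ) • hilbertMap ((S.alice s).op a) 1 S.state := by
  rw [bobObservable, ← (S.bob t).sum_op, hilbertMap_sum_smul_right, hilbertMap_sum_right,
    sum_apply, sum_apply, Finset.smul_sum]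
  refine Finset.sum_congr rfl fun b _ => ?_
  rw [smul_apply]
  by_cases hb : b = a t
  · rw [hb]
  · rw [(S.acceptProb_eq_one_iff s t).mp (hS s t) a b fun h => hb h.2, smul_zero, smul_zero]

theorem IsPerfect.hilbertMap_aliceObservable (hS : S.IsPerfect) (s : Fin m) (x : G.vars s) :
    hilbertMap (S.aliceObservable s x) 1 S.state = hilbertMap 1 (S.bobObservable x) S.state := by
  rw [aliceObservable, ← (S.alice s).sum_op, hilbertMap_sum_smul_left, hilbertMap_sum_left,
    sum_apply, sum_apply]
  exact Finset.sum_congr rfl fun a _ => (hS.hilbertMap_alice_bobObservable s x a).symm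

/-- The observable is moved to Bob's side, where it acts independently of E_a and can be replaced by
the sign. -/
theorem IsPerfect.hilbertMap_alice_mul_aliceObservable (hS : S.IsPerfect) (s : Fin m)
    (x : G.vars s) (a : G.vars s → Bool) :
    hilbertMap ((S.alice s).op a * S.aliceObservable s x) 1 S.state =
      hilbertMap ((boolSign (a x) : ℂ) • (S.alice s).op a) 1 S.state := by
  have h := hilbertMap_mul ((S.alice s).op a) (S.aliceObservable s x) (1 : HB →L[ℂ] HB) 1
  have h' := hilbertMap_mul ((S.alice s).op a) 1 (1 : HB →L[ℂ] HB) (S.bobObservable x)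
  rw [mul_one] at h h'
  rw [one_mul] at h'
  rw [h, mul_apply_eq_comp, hS.hilbertMap_aliceObservable, ← mul_apply_eq_comp, ← h',
    hS.hilbertMap_alice_bobObservable, ← hilbertMapBilinear_apply, ← hilbertMapBilinear_apply,
    map_smul, LinearMap.smul_apply, smul_apply]

variable {ι : Type w} {α : ι → ℝ} {φ : ι → HA} {χ : ι → HB}

theorem IsPerfect.aliceObservable_mem_span (hS : S.IsPerfect)
    (hψ : IsSchmidtForm S.state α φ χ) (i₀ : ι) (s : Fin m) (x : G.vars s) {v : HA}
    (hv : v ∈ Submodule.span ℂ (φ '' schmidtBlock α i₀)) :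
    S.aliceObservable s x v ∈ Submodule.span ℂ (φ '' schmidtBlock α i₀) :=
  hψ.apply_mem_span (S.isSymmetric_aliceObservable s x) (S.isSymmetric_bobObservable x)
    (hS.hilbertMap_aliceObservable s x) i₀ hv

theorem IsPerfect.aliceObservable_eq (hS : S.IsPerfect) (hψ : IsSchmidtForm S.state α φ χ)
    {s s' : Fin m} {i : Fin n} (hi : i ∈ G.vars s) (hi' : i ∈ G.vars s') (j : ι) :
    S.aliceObservable s ⟨i, hi⟩ (φ j) = S.aliceObservable s' ⟨i, hi'⟩ (φ j) :=
  hψ.apply_eq_of_hilbertMap_eq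
    ((hS.hilbertMap_aliceObservable s ⟨i, hi⟩).trans
      (hS.hilbertMap_aliceObservable s' ⟨i, hi'⟩).symm) j

theorem IsPerfect.alice_aliceObservable_apply (hS : S.IsPerfect)
    (hψ : IsSchmidtForm S.state α φ χ) (s : Fin m) (x : G.vars s) (a : G.vars s → Bool) (j : ι) :
    (S.alice s).op a (S.aliceObservable s x (φ j)) =
      (boolSign (a x) : ℂ) • (S.alice s).op a (φ j) :=
  hψ.apply_eq_of_hilbertMap_eq (hS.hilbertMap_alice_mul_aliceObservable s x a) j

theorem IsPerfect.alice_apply_eq_zero (hS : S.IsPerfect) (hψ : IsSchmidtForm S.state α φ χ)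
    (s : Fin m) {a : G.vars s → Bool} (ha : G.constraint s a ≠ true) (j : ι) :
    (S.alice s).op a (φ j) = 0 :=
  hψ.apply_eq_of_hilbertMap_eq (E' := 0) (by
    rw [hS.hilbertMap_alice_eq_zero s ha, ← hilbertMapBilinear_apply, map_zero]; rfl) j

/-! ### The satisfying assignment on a Schmidt block -/

section Assignment

variable (hS : S.IsPerfect) (hψ : IsSchmidtForm S.state α φ χ) (i₀ : ι)

open Classical in
/-- The restrictions of Alice's observables to the span of a Schmidt block; variables without a
constraint are assigned the identity. -/
noncomputable def blockAssignment (hS : S.IsPerfect) (hψ : IsSchmidtForm S.state α φ χ) (i₀ : ι)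
    (i : Fin n) : Submodule.span ℂ (φ '' schmidtBlock α i₀) →ₗ[ℂ]
      Submodule.span ℂ (φ '' schmidtBlock α i₀) :=
  if h : ∃ s, i ∈ G.vars s then
    (S.aliceObservable h.choose ⟨i, h.choose_spec⟩ : HA →ₗ[ℂ] HA).restrict
      fun _ hv => hS.aliceObservable_mem_span hψ i₀ _ _ hv
  else 1

theorem blockAssignment_apply (s : Fin m) (x : G.vars s)
    (y : Submodule.span ℂ (φ '' schmidtBlock α i₀)) :
    (blockAssignment hS hψ i₀ x y : HA) = S.aliceObservable s x y := by
  have h : ∃ s, (x : Fin n) ∈ G.vars s := ⟨s, x.2⟩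
  rw [blockAssignment, dif_pos h]
  -- The constraint picked in the definition may differ from s, but the two observables agree on the
  -- Schmidt vectors.
  exact ContinuousLinearMap.eq_of_mem_span_image (hS.aliceObservable_eq hψ h.choose_spec x.2) y.2

theorem blockAssignment_of_notMem {i : Fin n} (h : ¬ ∃ s, i ∈ G.vars s) :
    blockAssignment hS hψ i₀ i = 1 := dif_neg h

theorem alice_blockAssignment (s : Fin m) (x : G.vars s) (a : G.vars s → Bool)
    (y : Submodule.span ℂ (φ '' schmidtBlock α i₀)) :
    (S.alice s).op a (blockAssignment hS hψ i₀ x y) =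
      (boolSign (a x) : ℂ) • (S.alice s).op a y := by
  rw [blockAssignment_apply]
  exact ContinuousLinearMap.eq_of_mem_span_image (E := (S.alice s).op a * S.aliceObservable s x)
    (E' := (boolSign (a x) : ℂ) • (S.alice s).op a)
    (hS.alice_aliceObservable_apply hψ s x a) y.2

/-- E_a absorbs the leftmost factor as a sign, so a whole monomial is absorbed without any appeal to
commutativity. -/
theorem alice_list_prod_blockAssignment (s : Fin m) (a : G.vars s → Bool) (l : List (G.vars s))
    (y : Submodule.span ℂ (φ '' schmidtBlock α i₀)) :
    (S.alice s).op a ((l.map fun i : G.vars s => blockAssignment hS hψ i₀ i).prod y :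
        Submodule.span ℂ (φ '' schmidtBlock α i₀)) =
      (((l.map fun i => boolSign (a i)).prod : ℝ) : ℂ) • (S.alice s).op a y := by
  induction l with
  | nil => simp
  | cons x l ih =>
    rw [List.map_cons, List.prod_cons, Module.End.mul_apply, alice_blockAssignment, ih,
      List.map_cons, List.prod_cons, smul_smul, Complex.ofReal_mul]

theorem isQuantumSatisfyingAssignment_blockAssignment :
    G.IsQuantumSatisfyingAssignment (blockAssignment hS hψ i₀) where
  finiteDimensional := FiniteDimensional.span_of_finite ℂ ((hψ.finite_schmidtBlock i₀).image φ)
  nontrivial := ⟨⟨φ i₀, Submodule.subset_span (Set.mem_image_of_mem φ rfl)⟩, 0, fun h =>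
    hψ.left.ne_zero i₀ congr(($h : HA))⟩
  isSymmetric i x y := by
    by_cases h : ∃ s, i ∈ G.vars s
    · obtain ⟨s, hs⟩ := h
      have hx := blockAssignment_apply hS hψ i₀ s ⟨i, hs⟩ x
      have hy := blockAssignment_apply hS hψ i₀ s ⟨i, hs⟩ y
      rw [Submodule.coe_inner, Submodule.coe_inner, hx, hy]
      exact S.isSymmetric_aliceObservable s ⟨i, hs⟩ x y
    · rw [blockAssignment_of_notMem hS hψ i₀ h]; rfl
  sq_eq_one i := by
    by_cases h : ∃ s, i ∈ G.vars s
    · obtain ⟨s, hs⟩ := h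
      refine LinearMap.ext fun y => Subtype.ext ((S.alice s).ext_apply fun a => ?_)
      have hi := alice_blockAssignment hS hψ i₀ s ⟨i, hs⟩ a
      rw [Module.End.mul_apply, hi, hi, smul_smul, ← Complex.ofReal_mul, boolSign_mul_self]
      simp
    · rw [blockAssignment_of_notMem hS hψ i₀ h, mul_one]
  commute s i hi j hj := by
    refine LinearMap.ext fun y => Subtype.ext ((S.alice s).ext_apply fun a => ?_)
    have hi := alice_blockAssignment hS hψ i₀ s ⟨i, hi⟩ a
    have hj := alice_blockAssignment hS hψ i₀ s ⟨j, hj⟩ a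
    rw [Module.End.mul_apply, Module.End.mul_apply, hi, hj, hj, hi, smul_comm]
  satisfies s := by
    obtain ⟨p, hp⟩ := exists_multilinear_eq fun a => boolSign (G.constraint s a)
    refine ⟨p, hp, LinearMap.ext fun y => Subtype.ext ((S.alice s).ext_apply fun a => ?_)⟩
    have h1 : (S.alice s).op a (G.evalMultilinear s p (fun i => blockAssignment hS hψ i₀ i) y :
        Submodule.span ℂ (φ '' schmidtBlock α i₀)) =
        (boolSign (G.constraint s a) : ℂ) • (S.alice s).op a y := by
      rw [← hp a, evalMultilinear, LinearMap.sum_apply, Submodule.coe_sum, map_sum,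
        Complex.ofReal_sum, Finset.sum_smul]
      refine Finset.sum_congr rfl fun T _ => ?_
      rw [LinearMap.smul_apply, Submodule.coe_smul, map_smul, alice_list_prod_blockAssignment,
        smul_smul, Finset.list_prod_map_sort, Complex.ofReal_mul]
    rw [h1]
    -- A satisfying a gives the sign -1; for any other a the effect E_a annihilates the block, so
    -- the equation is trivial.
    by_cases ha : G.constraint s a = true
    · simp [ha, boolSign]
    · have h0 : (S.alice s).op a (y : HA) = 0 :=
        ContinuousLinearMap.eq_of_mem_span_image (E' := 0) (hS.alice_apply_eq_zero hψ s ha) y.2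
      simp [h0]

end Assignment

end BCS.Strategy

/-! ### The maximally entangled state of a block -/

section MaxEntangled

variable {ι : Type*} {HA : Type*} {HB : Type*}
  [NormedAddCommGroup HA] [InnerProductSpace ℂ HA]
  [NormedAddCommGroup HB] [InnerProductSpace ℂ HB]
  {ψ : HilbertTensor HA HB} {α : ι → ℝ} {φ : ι → HA} {χ : ι → HB}

theorem norm_maxEntangled (hφ : Orthonormal ℂ φ) (hχ : Orthonormal ℂ χ) {B : Finset ι}
    (hB : B.Nonempty) : ‖maxEntangled B φ χ‖ = 1 := by
  classical
  have h : ⟪∑ i ∈ B, hilbertTmul (φ i) (χ i), ∑ i ∈ B, hilbertTmul (φ i) (χ i)⟫_ℂ = B.card := by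
    rw [sum_inner]
    simp only [inner_sum, inner_hilbertTmul, orthonormal_iff_ite.mp hφ, orthonormal_iff_ite.mp hχ]
    simp
  have hc : (0 : ℝ) < B.card := by exact_mod_cast hB.card_pos
  have h2 : ‖∑ i ∈ B, hilbertTmul (φ i) (χ i)‖ = √B.card := by
    rw [norm_eq_sqrt_re_inner (𝕜 := ℂ), h]; simp
  rw [maxEntangled, norm_smul, h2, Complex.norm_real, norm_inv, Real.norm_eq_abs,
    abs_of_nonneg (Real.sqrt_nonneg _), inv_mul_cancel₀ (Real.sqrt_pos.mpr hc).ne']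

theorem hilbertMap_maxEntangled (E : HA →L[ℂ] HA) (F : HB →L[ℂ] HB) (B : Finset ι) :
    hilbertMap E F (maxEntangled B φ χ) =
      (((Real.sqrt B.card)⁻¹ : ℝ) : ℂ) • ∑ i ∈ B, hilbertTmul (E (φ i)) (F (χ i)) := by
  simp only [maxEntangled, map_smul, map_sum, hilbertMap_tmul]

/-- A symmetric operator commutes with the projection onto an invariant subspace. -/
theorem apply_starProjection_eq {A : HA →L[ℂ] HA} {V : Submodule ℂ HA}
    [V.HasOrthogonalProjection] (hA : (A : HA →ₗ[ℂ] HA).IsSymmetric) (hV : ∀ v ∈ V, A v ∈ V) :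
    A * V.starProjection = V.starProjection * A := by
  ext x
  rw [mul_apply_eq_comp, mul_apply_eq_comp]
  refine (Submodule.eq_starProjection_of_mem_orthogonal
    (hV _ (Submodule.starProjection_apply_mem V x)) ?_).symm
  rw [← map_sub, Submodule.mem_orthogonal]
  intro v hv
  have h := hA v (x - V.starProjection x)
  simp only [ContinuousLinearMap.coe_coe] at h
  rw [← h]
  exact (Submodule.mem_orthogonal _ _).mp (Submodule.sub_starProjection_mem_orthogonal x) _
    (hV v hv)

/-- The relation `(A ⊗ 1) ψ = (1 ⊗ B) ψ` passes to the maximally entangled state of a Schmidt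
block. -/
theorem IsSchmidtForm.hilbertMap_maxEntangled_eq (h : IsSchmidtForm ψ α φ χ) {A : HA →L[ℂ] HA}
    {B : HB →L[ℂ] HB} (hA : (A : HA →ₗ[ℂ] HA).IsSymmetric) (hB : (B : HB →ₗ[ℂ] HB).IsSymmetric)
    (hAB : hilbertMap A 1 ψ = hilbertMap 1 B ψ) (i₀ : ι) (hfin : (schmidtBlock α i₀).Finite) :
    hilbertMap A 1 (maxEntangled hfin.toFinset φ χ) =
      hilbertMap 1 B (maxEntangled hfin.toFinset φ χ) := by
  set V := Submodule.span ℂ (φ '' schmidtBlock α i₀) with hV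
  have : FiniteDimensional ℂ V := FiniteDimensional.span_of_finite ℂ (hfin.image φ)
  set Φ := ∑ i ∈ hfin.toFinset, hilbertTmul (φ i) (χ i) with hΦ
  -- Projecting Alice's side keeps exactly the terms of the block, which share the coefficient
  -- α_{i₀}.
  have hQ : hilbertMap V.starProjection 1 ψ = (α i₀ : ℂ) • Φ := by
    refine (h.hasSum_hilbertMap _ _).unique ?_
    rw [hΦ, Finset.smul_sum]
    convert hasSum_sum_of_ne_finset_zero (s := hfin.toFinset)
      (L := SummationFilter.unconditional ι) fun i hi => ?_ using 1
    · refine Finset.sum_congr rfl fun i hi => ?_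
      have hi : i ∈ schmidtBlock α i₀ := hfin.mem_toFinset.mp hi
      have hαi : α i = α i₀ := hi
      have : V.starProjection (φ i) = φ i := Submodule.starProjection_eq_self_iff.mpr
        (Submodule.subset_span (Set.mem_image_of_mem φ hi))
      rw [this, hαi, one_apply_eq_self]
    · have : V.starProjection (φ i) = 0 := by
        rw [Submodule.starProjection_apply_eq_zero_iff, Submodule.mem_orthogonal]
        intro u hu
        refine Submodule.span_induction ?_ (inner_zero_left _) (fun x y _ _ hx hy => ?_)
          (fun c x _ hx => ?_) hu
        · rintro _ ⟨j, hj, rfl⟩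
          exact h.left.2 fun e => hi (hfin.mem_toFinset.mpr (e ▸ hj))
        · rw [inner_add_left, hx, hy, add_zero]
        · rw [inner_smul_left, hx, mul_zero]
      rw [this, hilbertTmul_zero_left, smul_zero]
  have hcomm := apply_starProjection_eq (V := V) hA fun v hv => h.apply_mem_span hA hB hAB i₀ hv
  -- The projection acts on Alice's side, so it commutes with 1 ⊗ B; it commutes with A by
  -- invariance of the block.
  have key : hilbertMap A 1 ((α i₀ : ℂ) • Φ) = hilbertMap 1 B ((α i₀ : ℂ) • Φ) := by
    rw [← hQ, ← mul_apply_eq_comp, ← mul_apply_eq_comp, ← hilbertMap_mul, ← hilbertMap_mul,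
      hcomm, hilbertMap_mul, mul_apply_eq_comp, hAB, ← mul_apply_eq_comp, ← hilbertMap_mul,
      one_mul, one_mul, mul_one, mul_one]
  rw [map_smul, map_smul] at key
  rw [maxEntangled, map_smul, map_smul, smul_right_injective _ (h.ne_zero i₀) key]

end MaxEntangled

namespace BCS.Strategy

variable {n m : ℕ} {G : BCS n m} {HA : Type u} {HB : Type v}
  [NormedAddCommGroup HA] [InnerProductSpace ℂ HA] [CompleteSpace HA]
  [NormedAddCommGroup HB] [InnerProductSpace ℂ HB] [CompleteSpace HB]
  {S S' : G.Strategy HA HB} {ι : Type w} {α : ι → ℝ} {φ : ι → HA} {χ : ι → HB}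

/-- Replacing the state of a perfect strategy by the maximally entangled state of a Schmidt block
leaves it perfect. -/
theorem IsPerfect.of_state_eq_maxEntangled (hS : S.IsPerfect)
    (hψ : IsSchmidtForm S.state α φ χ) (i₀ : ι) (hfin : (schmidtBlock α i₀).Finite)
    (hstate : S'.state = maxEntangled hfin.toFinset φ χ) (halice : S'.alice = S.alice)
    (hbob : S'.bob = S.bob) : S'.IsPerfect := by
  intro s t
  rw [acceptProb_eq_one_iff, hstate, halice, hbob]
  intro a b hab
  by_cases ha : G.constraint s a = true
  · have hb : b ≠ a t := fun e => hab ⟨ha, e⟩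
    set Φ := maxEntangled hfin.toFinset φ χ with hΦ
    have h1 : hilbertMap ((S.alice s).op a) (S.bobObservable t) Φ =
        (boolSign (a t) : ℂ) • hilbertMap ((S.alice s).op a) 1 Φ := by
      have e1 := hilbertMap_mul ((S.alice s).op a) 1 (1 : HB →L[ℂ] HB) (S.bobObservable t)
      have e2 := hilbertMap_mul ((S.alice s).op a) (S.aliceObservable s t) (1 : HB →L[ℂ] HB) 1
      rw [mul_one, one_mul] at e1
      rw [mul_one] at e2
      rw [e1, mul_apply_eq_comp, ← hψ.hilbertMap_maxEntangled_eq
        (S.isSymmetric_aliceObservable s t) (S.isSymmetric_bobObservable t)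
        (hS.hilbertMap_aliceObservable s t) i₀ hfin, ← mul_apply_eq_comp, ← e2,
        hilbertMap_maxEntangled, hilbertMap_maxEntangled,
        smul_comm (boolSign (a t) : ℂ), Finset.smul_sum (r := (boolSign (a t) : ℂ))]
      simp only [mul_apply_eq_comp, hS.alice_aliceObservable_apply hψ, hilbertTmul_smul_left]
    rw [← (S.bob t).sum_op, bobObservable, hilbertMap_sum_smul_right, hilbertMap_sum_right,
      Fintype.sum_bool, Fintype.sum_bool] at h1
    simp only [add_apply, smul_apply] at h1
    -- The difference of Bob's observable and the scalar (-1)^(a_t) is ±2 times his effect for the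
    -- outcome b ≠ a_t.
    have h2 : (2 : ℂ) • hilbertMap ((S.alice s).op a) ((S.bob t).op b) Φ = 0 := by
      cases b <;> cases hat : a t <;> simp [hat, boolSign] at hb h1
      · linear_combination (norm := module) h1
      · linear_combination (norm := module) -h1
    simpa using h2
  -- For an unsatisfying a, E_a kills every φ_i, hence every term of the new state.
  · rw [hilbertMap_maxEntangled]
    simp [hS.alice_apply_eq_zero hψ s ha]

end BCS.Strategy

/-! ### The main theorem -/

theorem theorem1 {n m : ℕ} (G : BCS n m) {HA : Type u} {HB : Type v}
    [NormedAddCommGroup HA] [InnerProductSpace ℂ HA] [CompleteSpace HA]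
    [NormedAddCommGroup HB] [InnerProductSpace ℂ HB] [CompleteSpace HB]
    (S : G.Strategy HA HB)
    {ι : Type w} [Countable ι] (α : ι → ℝ) (φ : ι → HA) (χ : ι → HB)
    (hS : IsSchmidtForm S.state α φ χ) (hperfect : S.IsPerfect) :
    G.HasQuantumSatisfyingAssignment ∧
    ∀ i₀ : ι, ∃ hfin : (schmidtBlock α i₀).Finite,
      (∃ A : Fin n → Submodule.span ℂ (φ '' schmidtBlock α i₀) →ₗ[ℂ]
            Submodule.span ℂ (φ '' schmidtBlock α i₀),
        G.IsQuantumSatisfyingAssignment A ∧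
        ∀ (s : Fin m) (x : G.vars s) (y : Submodule.span ℂ (φ '' schmidtBlock α i₀)),
          (A x y : HA) = S.aliceObservable s x y) ∧
      ∃ S' : G.Strategy HA HB, S'.state = maxEntangled hfin.toFinset φ χ ∧
        S'.alice = S.alice ∧ S'.bob = S.bob ∧ S'.IsPerfect := by
  have hne : S.state ≠ 0 := fun h => by simpa [h] using S.norm_state
  -- ψ is a unit vector, so some Schmidt block exists; any one yields the first claim.
  obtain ⟨i₁⟩ := hS.nonempty hne
  refine ⟨(BCS.Strategy.isQuantumSatisfyingAssignment_blockAssignment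
    hperfect hS i₁).hasQuantumSatisfyingAssignment, fun i₀ => ?_⟩
  have hfin := hS.finite_schmidtBlock i₀
  refine ⟨hfin, ⟨_, BCS.Strategy.isQuantumSatisfyingAssignment_blockAssignment hperfect hS i₀,
    BCS.Strategy.blockAssignment_apply hperfect hS i₀⟩,
    ⟨maxEntangled hfin.toFinset φ χ, norm_maxEntangled hS.left hS.right
      ⟨i₀, hfin.mem_toFinset.mpr rfl⟩, S.alice, S.bob⟩, rfl, rfl, rfl, ?_⟩
  exact hperfect.of_state_eq_maxEntangled hS i₀ hfin rfl rfl rfl
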